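/- For a positive integer $m$, let $\Omega_m=\{0,1,-1,\dots,m,-m\}$ and let $\mathfrak{B}_m$ be the hyperoctahedral group of signed permutations of length $m$, i.e. the bijections $\pi:\Omega_m\to\Omega_m$ with $\pi(-a)=-\pi(a)$ for all $a\in\Omega_m$. A fixed-point-free signed involution is an element $\pi\in\mathfrak{B}_m$ with $\pi^{-1}=\pi$ such that $\pi(i)\ne i$ and $\pi(i)\ne -i$ for every $i\in\{1,\dots,m\}$. The number of natural-order descents of $\pi$ is $$\mathrm{des}^B(\pi)=\#\{\,i\in\{0,1,\dots,m-1\} : \pi(i)>\pi(i+1)\,\},$$ where $\pi(0)=0$ and $>$ is the usual order on $\mathbb{Z}$. For an integer $k$, let $J^{\overline{B}}_{m,k}$ be the number of fixed-point-free signed involutions $\pi\in\mathfrak{B}_m$ with $\mathrm{des}^B(\pi)=k$. **Theorem.** For all integers $n\ge 2$ and $k\ge 0$, $$\begin{aligned} n\,J^{\overline{B}}_{2n,k}={}&(k^2+k+n-1)\,J^{\overline{B}}_{2n-2,k}+2\bigl((k-1)(2n-k-1)+n\bigr)\,J^{\overline{B}}_{2n-2,k-1}\\&+\bigl((2n-k)(2n-k+1)+(n-1)\bigr)\,J^{\overline{B}}_{2n-2,k-2}.\end{aligned}$$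 Moreover $J^{\overline{B}}_{2,0}=0$, $J^{\overline{B}}_{2,1}=2$, $J^{\overline{B}}_{2,2}=0$, and $J^{\overline{B}}_{2n,k}=0$ for all $n\ge1$ and $k<0$. -/

import Mathlib

/-- `Ω_n = {0, 1, -1, …, n, -n}`, ordered by the natural order of `ℤ`. -/
abbrev SignedSet (n : ℕ) : Type := {a : ℤ // a ∈ Finset.Icc (-(n : ℤ)) n}

instance SignedSet.instNeg (n : ℕ) : Neg (SignedSet n) :=
  ⟨fun a => ⟨-a.1, by
    have h := Finset.mem_Icc.1 a.2
    exact Finset.mem_Icc.2 ⟨by omega, by omega⟩⟩⟩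

/-- The group `𝔅_n` of signed permutations of length `n`: the bijections `π : Ω_n → Ω_n` such that
`π(a) = b` implies `π(-a) = -b`. -/
def SignedPerm (n : ℕ) : Subgroup (Equiv.Perm (SignedSet n)) where
  carrier := {π | ∀ a, π (-a) = -π a}
  one_mem' := fun _ => rfl
  mul_mem' := by
    intro π σ hπ hσ a
    change π (σ (-a)) = -π (σ a)
    rw [hσ, hπ]
  inv_mem' := by
    intro π hπ a
    change π.symm (-a) = -π.symm a
    rw [Equiv.symm_apply_eq, hπ, Equiv.apply_symm_apply]

namespace SignedPerm

/-- The element `i` of `Ω_n`, for `i ∈ {0, 1, …, n}`. -/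
def pos {n : ℕ} (i : Fin (n + 1)) : SignedSet n :=
  ⟨(i.val : ℤ), by
    have h := i.isLt
    exact Finset.mem_Icc.2 ⟨by omega, by omega⟩⟩

/-- The descent set in the natural order: all `i ∈ {0, …, n-1}` with `π_i > π_{i+1}`
(here `π_0 = π(0) = 0`). -/
def descentSet {n : ℕ} (π : SignedPerm n) : Finset (Fin n) :=
  Finset.univ.filter fun i => (π.1 (pos i.castSucc) : ℤ) > (π.1 (pos i.succ) : ℤ)

/-- The number of natural-order descents. -/
def des {n : ℕ} (π : SignedPerm n) : ℕ := (descentSet π).card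

/-- `π` is a fixed-point-free signed involution: `π⁻¹ = π`, and `π(i) ≠ i` and `π(i) ≠ -i` for
each `i ∈ {1, …, n}`. -/
def IsFixedPointFreeInvolution {n : ℕ} (π : SignedPerm n) : Prop :=
  π⁻¹ = π ∧ ∀ i : Fin n, π.1 (pos i.succ) ≠ pos i.succ ∧ π.1 (pos i.succ) ≠ -pos i.succ

/-- The number of fixed-point-free signed involutions in `𝔅_n` with exactly `k` natural-order
descents; the index `k` is an integer. -/
noncomputable def numFPFInvolutions (n : ℕ) (k : ℤ) : ℕ :=
  {π : SignedPerm n | IsFixedPointFreeInvolution π ∧ (des π : ℤ) = k}.ncard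

end SignedPerm

/-!
Call a pair `(π, a)` compatible if `a : Ω_N → [-r, r]` is odd and `x ↦ (a x, π x)` increases
lexicographically. For fixed `π`, adding to `a` the number of earlier non-descents of `π` makes the
labels strictly increasing, so there are `(r + N - des π).choose N` compatible `a`.

If `π` is a fixed-point-free signed involution and `N = 2 n`, then `Ω_N \ {0}` consists of `n`
orbits `{x, -x, π x, -π x}`. Writing down `(a x, a (π x))` for the largest `x` of each orbit gives a
multiset of `n` pairs `(c, d)` with `-c ≤ d < c ≤ r`. There are `r (r + 1)` such pairs, and every
multiset of `n` of them arises from exactly one compatible `(π, a)`. Hence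
`∑ J_{2n,k} X^k = (1 - X)^(2n+1) ∑ h_n(r) X^r`, where `h_n(r) = (r (r + 1)).multichoose n`.

The recurrence is the translation of `(n + 1) h_{n+1}(r) = (r² + r + n) h_n(r)`: multiplying the
`r`-th coefficient by `r` is the Euler operator `X d/dX`, and commuting that operator twice past
`(1 - X)^(2n+1)` leaves a polynomial of degree two in `X`.
-/

/-! ### The Euler operator -/

section PowerSeriesIdentities

open PowerSeries

variable {R : Type*} [CommRing R]

variable (R) in
/-- The Euler operator `X d/dX` on power series, which multiplies the `r`-th coefficient by `r`. -/
noncomputable def eulerDerivation : Derivation R R⟦X⟧ R⟦X⟧ :=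
  (X : R⟦X⟧) • derivative R

theorem coeff_eulerDerivation (f : R⟦X⟧) (r : ℕ) :
    coeff r (eulerDerivation R f) = r * coeff r f := by
  cases r with
  | zero => simp [eulerDerivation]
  | succ r => simp [eulerDerivation, coeff_succ_X_mul, coeff_derivative, mul_comm]

theorem eulerDerivation_X : eulerDerivation R X = X := by
  simp [eulerDerivation]

theorem eulerDerivation_one_sub_X_pow_succ (M : ℕ) :
    eulerDerivation R ((1 - X) ^ (M + 1)) = -((M + 1 : R⟦X⟧) * X * (1 - X) ^ M) := by
  rw [Derivation.leibniz_pow, map_sub, eulerDerivation_X, Derivation.map_one_eq_zero]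
  simp only [nsmul_eq_mul, smul_eq_mul, add_tsub_cancel_right]
  push_cast
  ring

theorem eulerDerivation_sq_add_mul_one_sub_X_pow {f g : R⟦X⟧} {M : ℕ}
    (hg : f * (1 - X) ^ (M + 1) = g) (c : R) :
    (eulerDerivation R (eulerDerivation R f) + eulerDerivation R f + C c * f) *
        (1 - X) ^ (M + 3) =
      (eulerDerivation R (eulerDerivation R g) + eulerDerivation R g + C c * g) +
      X * (C (2 * M : R) * eulerDerivation R g - C 2 * eulerDerivation R (eulerDerivation R g)
        + C (2 * (M + 1 - c)) * g) +
      X ^ 2 * (eulerDerivation R (eulerDerivation R g) - C (2 * M + 1 : R) * eulerDerivation R g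
        + C (M * (M + 1) + c) * g) := by
  have first_order : (1 - X) * eulerDerivation R g =
      (1 - X) ^ (M + 2) * eulerDerivation R f - (M + 1 : R⟦X⟧) * X * g := by
    rw [← hg, Derivation.leibniz, eulerDerivation_one_sub_X_pow_succ]
    simp only [smul_eq_mul]
    ring
  have second_order :
      (1 - X) * eulerDerivation R (eulerDerivation R g) - X * eulerDerivation R g =
        (1 - X) ^ (M + 2) * eulerDerivation R (eulerDerivation R f)
          - (M + 2 : R⟦X⟧) * X * (1 - X) ^ (M + 1) * eulerDerivation R f
          - (M + 1 : R⟦X⟧) * X * (g + eulerDerivation R g) := by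
    have := congrArg (eulerDerivation R) first_order
    simp only [Derivation.leibniz, map_sub, map_add, eulerDerivation_X, smul_eq_mul,
      eulerDerivation_one_sub_X_pow_succ, Derivation.map_one_eq_zero, Derivation.map_natCast]
      at this
    push_cast at this
    linear_combination this
  simp only [map_add, map_sub, map_mul, map_natCast, map_ofNat, map_one]
  linear_combination (-(1 - X)) * second_order - (1 - X + (M + 2) * X) * first_order
    + C c * (1 - X) ^ 2 * hg

theorem succ_mul_multichoose_succ (a n : ℕ) :
    (n + 1) * a.multichoose (n + 1) = (a + n) * a.multichoose n := by
  rcases a.eq_zero_or_pos with rfl | ha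
  · cases n <;> simp
  · obtain ⟨b, rfl⟩ := Nat.exists_eq_add_of_lt ha
    simp only [Nat.multichoose_eq]
    have := Nat.add_one_mul_choose_eq (b + n) n
    grind

theorem three_term_of_mul_one_sub_X_pow {f f' : ℕ → ℤ} {g g' : ℤ → ℤ} {M : ℕ} {b c : ℤ}
    (hf : ∀ r : ℕ, b * f' r = (r ^ 2 + r + c) * f r)
    (hg : mk f * (1 - X) ^ (M + 1) = mk fun k => g k)
    (hg' : mk f' * (1 - X) ^ (M + 3) = mk fun k => g' k)
    (g_neg : ∀ k < 0, g k = 0) (k : ℕ) :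
    b * g' k = (k ^ 2 + k + c) * g k
      + 2 * (M * (k - 1) - (k - 1) ^ 2 + (M + 1 - c)) * g (k - 1)
      + ((k - 2) ^ 2 - (2 * M + 1) * (k - 2) + (M * (M + 1) + c)) * g (k - 2) := by
  have hf' : C b * mk f' =
      eulerDerivation ℤ (eulerDerivation ℤ (mk f)) + eulerDerivation ℤ (mk f) + C c * mk f := by
    ext r
    simp only [map_add, coeff_eulerDerivation, coeff_C_mul, coeff_mk, hf]
    ring
  have shift (d : ℕ) (F : ℤ⟦X⟧) (p : ℤ → ℤ) (hF : ∀ i, coeff i F = p i * g i) :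
      coeff k (X ^ d * F) = p (k - d) * g (k - d) := by
    rw [coeff_X_pow_mul']
    split_ifs with h
    · rw [hF, Nat.cast_sub h]
    · rw [g_neg _ (by omega), mul_zero]
  have shift_one (F : ℤ⟦X⟧) (p : ℤ → ℤ) (hF : ∀ i, coeff i F = p i * g i) :
      coeff k (X * F) = p (k - 1) * g (k - 1) := by
    simpa only [pow_one, Nat.cast_one] using shift 1 F p hF
  have key := congrArg (coeff k) (eulerDerivation_sq_add_mul_one_sub_X_pow hg c)
  rw [← hf', mul_assoc, hg', coeff_C_mul, coeff_mk, map_add, map_add,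
    shift_one _ (fun i => 2 * (M * i - i ^ 2 + (M + 1 - c))),
    shift 2 _ (fun i => i ^ 2 - (2 * M + 1) * i + (M * (M + 1) + c))] at key
  · simp only [map_add, coeff_eulerDerivation, coeff_C_mul, coeff_mk] at key
    push_cast at key
    linear_combination key
  all_goals
    intro i
    simp only [LinearMap.map_add, LinearMap.map_sub, coeff_eulerDerivation, coeff_C_mul, coeff_mk]
    ring

end PowerSeriesIdentities

/-! ### Odd functions on `Ω_N` -/

namespace SignedSet

open SignedPerm

variable {N : ℕ}

instance instInvolutiveNeg : InvolutiveNeg (SignedSet N) where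
  toNeg := instNeg N
  neg_neg x := Subtype.ext (neg_neg x.1)

instance instNegZeroClass : NegZeroClass (SignedSet N) where
  toNeg := instNeg N
  zero := ⟨0, Finset.mem_Icc.2 ⟨by omega, by omega⟩⟩
  neg_zero := rfl

theorem card_eq : Fintype.card (SignedSet N) = 2 * N + 1 := by
  rw [Fintype.card_coe, Int.card_Icc]
  omega

@[simp] theorem coe_neg (x : SignedSet N) : ((-x : SignedSet N) : ℤ) = -x := rfl

@[simp] theorem coe_zero : ((0 : SignedSet N) : ℤ) = 0 := rfl

@[simp] theorem coe_pos (i : Fin (N + 1)) : ((pos i : SignedSet N) : ℤ) = (i : ℕ) := rfl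

theorem natAbs_lt (x : SignedSet N) : (x : ℤ).natAbs < N + 1 := by
  have := Finset.mem_Icc.1 x.2
  omega

theorem pos_strictMono : StrictMono (pos : Fin (N + 1) → SignedSet N) := fun _ _ h =>
  Int.ofNat_lt.2 h

theorem le_pos_last (x : SignedSet N) : x ≤ pos (Fin.last N) :=
  (Finset.mem_Icc.1 x.2).2

theorem pos_zero : pos 0 = (0 : SignedSet N) := rfl

theorem pos_succ_ne_zero (i : Fin N) : pos i.succ ≠ (0 : SignedSet N) :=
  (pos_strictMono i.succ_pos).ne'

theorem pos_natAbs_of_nonneg {x : SignedSet N} (hx : 0 ≤ x) :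
    pos ⟨(x : ℤ).natAbs, x.natAbs_lt⟩ = x :=
  Subtype.ext (Int.natAbs_of_nonneg hx)

theorem neg_lt_neg_iff {x y : SignedSet N} : -x < -y ↔ y < x :=
  _root_.neg_lt_neg_iff (α := ℤ)

theorem neg_nonneg {x : SignedSet N} : 0 ≤ -x ↔ x ≤ 0 :=
  _root_.neg_nonneg (α := ℤ)

theorem forall_iff_pos {p : SignedSet N → Prop} (hp : ∀ x, p x → p (-x)) :
    (∀ x, p x) ↔ ∀ i, p (pos i) := by
  refine ⟨fun h i => h _, fun h x => ?_⟩
  rcases le_total 0 x with hx | hx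
  · exact pos_natAbs_of_nonneg hx ▸ h _
  · have := hp _ (pos_natAbs_of_nonneg (neg_nonneg.2 hx) ▸ h _)
    rwa [neg_neg] at this

theorem strictMono_iff_of_odd {L : Type*} [AddCommGroup L] [LinearOrder L] [IsOrderedAddMonoid L]
    {f : SignedSet N → L} (hf : f.Odd) :
    StrictMono f ↔ ∀ i : Fin N, f (pos i.castSucc) < f (pos i.succ) := by
  constructor
  · exact fun h i => h (pos_strictMono i.castSucc_lt_succ)
  intro h
  have mono_pos : StrictMono fun i : Fin (N + 1) => f (pos i) := Fin.strictMono_iff_lt_succ.2 h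
  have of_nonneg {x y : SignedSet N} (hx : 0 ≤ x) (hxy : x < y) : f x < f y := by
    rw [← pos_natAbs_of_nonneg hx, ← pos_natAbs_of_nonneg (hx.trans hxy.le)]
    exact mono_pos (Int.natAbs_lt_natAbs_of_nonneg_of_lt hx hxy)
  have of_nonpos {x y : SignedSet N} (hy : y ≤ 0) (hxy : x < y) : f x < f y := by
    have := of_nonneg (neg_nonneg.2 hy) (neg_lt_neg_iff.2 hxy)
    rwa [hf, hf, _root_.neg_lt_neg_iff] at this
  intro x y hxy
  rcases le_or_gt 0 x with hx | hx
  · exact of_nonneg hx hxy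
  rcases le_or_gt y 0 with hy | hy
  · exact of_nonpos hy hxy
  · exact (of_nonpos le_rfl hx).trans (of_nonneg le_rfl hy)

/-- The odd function on `Ω_N` with prescribed values on `{0, …, N}`; the value prescribed at `0` is
ignored, as oddness requires. -/
def oddExtension {L : Type*} [AddCommGroup L] (B : Fin (N + 1) → L) (x : SignedSet N) : L :=
  Int.sign x • B ⟨(x : ℤ).natAbs, x.natAbs_lt⟩

section OddExtension

variable {L : Type*} [AddCommGroup L]

theorem odd_oddExtension (B : Fin (N + 1) → L) : (oddExtension B).Odd := by
  intro x
  simp [oddExtension]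

theorem oddExtension_pos {B : Fin (N + 1) → L} (hB : B 0 = 0) (i : Fin (N + 1)) :
    oddExtension B (pos i) = B i := by
  rcases eq_or_ne i 0 with rfl | hi
  · simp [oddExtension, hB]
  · have : Int.sign (i : ℕ) = 1 :=
      Int.sign_eq_one_of_pos (Int.natCast_pos.2 (Fin.pos_iff_ne_zero.2 hi))
    simp [oddExtension, this]

theorem eq_of_odd_of_eq_pos {f g : SignedSet N → L} (hf : f.Odd) (hg : g.Odd)
    (h : ∀ i, f (pos i) = g (pos i)) : f = g := by
  funext x
  revert x
  exact (forall_iff_pos fun x hx => by rw [hf, hg, hx]).2 h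

end OddExtension

end SignedSet

namespace SignedPerm

open SignedSet

variable {N : ℕ} {π : SignedPerm N}

theorem apply_odd (π : SignedPerm N) : Function.Odd π.1 := π.2

theorem apply_zero (π : SignedPerm N) : π.1 0 = 0 := by
  have h := congrArg Subtype.val (apply_odd π 0)
  rw [neg_zero, coe_neg] at h
  exact Subtype.ext (self_eq_neg.1 h)

theorem des_le (π : SignedPerm N) : des π ≤ N :=
  (Finset.card_le_univ _).trans_eq (Fintype.card_fin N)

theorem isFixedPointFreeInvolution_iff :
    IsFixedPointFreeInvolution π ↔
      Function.Involutive π.1 ∧ ∀ x ≠ 0, π.1 x ≠ x ∧ π.1 x ≠ -x := by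
  have inv_eq : π⁻¹ = π ↔ Function.Involutive π.1 := by
    rw [inv_eq_iff_mul_eq_one, Subtype.ext_iff, Equiv.ext_iff]
    rfl
  have pos_cond : (∀ i : Fin N, π.1 (pos i.succ) ≠ pos i.succ ∧ π.1 (pos i.succ) ≠ -pos i.succ) ↔
      ∀ x ≠ 0, π.1 x ≠ x ∧ π.1 x ≠ -x := by
    rw [forall_iff_pos, Fin.forall_fin_succ]
    · simp only [pos_zero, ne_eq, not_true_eq_false, IsEmpty.forall_iff, pos_succ_ne_zero,
        not_false_eq_true, forall_const, true_and]
    · intro x hx hx0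
      rw [apply_odd π x, Ne, Ne, neg_inj, neg_neg, neg_eq_iff_eq_neg]
      exact hx fun h => hx0 (by rw [h, neg_zero])
  rw [IsFixedPointFreeInvolution, inv_eq, pos_cond]

end SignedPerm

/-! ### Compatible labellings -/

theorem card_strictMono_fin_succ (N K : ℕ) :
    Nat.card {A : Fin (N + 1) → ℤ // A 0 = 0 ∧ StrictMono A ∧ A (Fin.last N) ≤ K} = K.choose N := by
  have card_Ioc : Nat.card (Set.Ioc (0 : ℤ) K) = K := by simp
  rw [← card_Ioc, ← Set.powersetCard.card, ← Nat.card_congr Set.powersetCard.ofFinEmbEquiv,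
    card_Ioc]
  refine Nat.card_congr
    { toFun A := OrderEmbedding.ofStrictMono
        (fun i => ⟨A.1 i.succ, A.2.1.symm.trans_lt (A.2.2.1 i.succ_pos),
          (A.2.2.1.monotone (Fin.le_last _)).trans A.2.2.2⟩)
        fun i j h => A.2.2.1 (Fin.succ_lt_succ_iff.2 h)
      invFun e := ⟨Fin.cons 0 fun i => (e i : ℤ), rfl,
        Fin.strictMono_cons.2 ⟨fun i => (e i).2.1, fun i j h => e.strictMono h⟩, ?_⟩
      left_inv A := Subtype.ext (funext fun i => ?_)
      right_inv e := by ext; rfl }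
  · cases N with
    | zero => simp
    | succ N => exact (e (Fin.last N)).2.2
  · cases i using Fin.cases with
    | zero => exact A.2.1.symm
    | succ i => rfl

namespace SignedPerm

open SignedSet

variable {N r : ℕ} {π : SignedPerm N} {a : SignedSet N → ℤ}

/-- Odd labellings of `Ω_N` by integers in `[-r, r]` which are `P`-partitions for `π`: they increase
weakly along `Ω_N`, and `π` increases on each run of equal labels. -/
structure Compatible (π : SignedPerm N) (r : ℕ) (a : SignedSet N → ℤ) : Prop where
  odd : a.Odd
  strictMono : StrictMono fun x => toLex (a x, (π.1 x : ℤ))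
  le : ∀ x, a x ≤ r

theorem Compatible.monotone (ha : Compatible π r a) : Monotone a :=
  Prod.Lex.monotone_fst_ofLex.comp ha.strictMono.monotone

/-- The number of positions before `i` at which `π` does not descend. Adding it to a compatible
labelling makes the labels strictly increasing. -/
def ascentsBefore (π : SignedPerm N) : Fin (N + 1) → ℤ :=
  Fin.partialSum fun i => if i ∈ descentSet π then 0 else 1

theorem ascentsBefore_zero (π : SignedPerm N) : ascentsBefore π 0 = 0 :=
  Fin.partialSum_zero _

theorem ascentsBefore_last (π : SignedPerm N) : ascentsBefore π (Fin.last N) = N - des π := by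
  have h : ascentsBefore π (Fin.last N) = ∑ i, if i ∈ descentSet π then (0 : ℤ) else 1 := by
    rw [ascentsBefore, Fin.partialSum, ← List.sum_ofFn, List.take_of_length_le (by simp)]
  rw [h, Finset.sum_ite, Finset.sum_const_zero, zero_add, Finset.sum_const, nsmul_one,
    Finset.filter_not, Finset.card_sdiff_of_subset (by simp), Finset.filter_mem_eq_inter,
    Finset.univ_inter, Finset.card_univ, Fintype.card_fin, ← des,
    Nat.cast_sub (des_le π)]

theorem toLex_lt_succ_iff {A : Fin (N + 1) → ℤ} (i : Fin N) :
    toLex (A i.castSucc, (π.1 (pos i.castSucc) : ℤ)) < toLex (A i.succ, (π.1 (pos i.succ) : ℤ)) ↔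
      (A + ascentsBefore π) i.castSucc < (A + ascentsBefore π) i.succ := by
  have image_ne : (π.1 (pos i.castSucc) : ℤ) ≠ π.1 (pos i.succ) := fun h =>
    (pos_strictMono i.castSucc_lt_succ).ne (π.1.injective (Subtype.ext h))
  have mem : i ∈ descentSet π ↔ (π.1 (pos i.succ) : ℤ) < π.1 (pos i.castSucc) := by
    simp [descentSet]
  simp only [Prod.Lex.toLex_lt_toLex, Pi.add_apply, ascentsBefore, Fin.partialSum_succ, mem]
  split_ifs <;> omega

theorem compatible_iff : Compatible π r a ↔
    a.Odd ∧ StrictMono ((fun i => a (pos i)) + ascentsBefore π) ∧ a (pos (Fin.last N)) ≤ r := by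
  have key (ha : a.Odd) : StrictMono (fun x => toLex (a x, (π.1 x : ℤ))) ↔
      StrictMono ((fun i => a (pos i)) + ascentsBefore π) := by
    have odd : Function.Odd fun x => toLex (a x, (π.1 x : ℤ)) := fun x => by
      simp only [ha x, apply_odd π x]
      rfl
    rw [strictMono_iff_of_odd odd, Fin.strictMono_iff_lt_succ]
    exact forall_congr' fun i => toLex_lt_succ_iff (A := fun i => a (pos i)) i
  constructor
  · exact fun ha => ⟨ha.odd, (key ha.odd).1 ha.strictMono, ha.le _⟩
  · rintro ⟨ha, hmono, hle⟩
    have strictMono := (key ha).2 hmono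
    exact ⟨ha, strictMono, fun x =>
      (Prod.Lex.monotone_fst_ofLex.comp strictMono.monotone (le_pos_last x)).trans hle⟩

theorem card_compatible (π : SignedPerm N) (r : ℕ) :
    Nat.card {a // Compatible π r a} = (r + N - des π).choose N := by
  have des_le := des_le π
  have label_zero {a : SignedSet N → ℤ} (ha : a.Odd) :
      ((fun i => a (pos i)) + ascentsBefore π) 0 = 0 := by
    simp [ascentsBefore_zero, pos_zero, ha.map_zero]
  have apply_pos {A : Fin (N + 1) → ℤ} (hA : A 0 = 0) :
      (fun i => oddExtension (A - ascentsBefore π) (pos i)) = A - ascentsBefore π :=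
    funext (oddExtension_pos (by simp [hA, ascentsBefore_zero]))
  rw [← card_strictMono_fin_succ]
  refine Nat.card_congr
    { toFun a := ⟨(fun i => a.1 (pos i)) + ascentsBefore π, label_zero a.2.odd, ?_⟩
      invFun A := ⟨oddExtension (A.1 - ascentsBefore π), ?_⟩
      left_inv a := Subtype.ext (eq_of_odd_of_eq_pos (odd_oddExtension _) a.2.odd
        (congrFun ?_))
      right_inv A := Subtype.ext ?_ }
  · obtain ⟨-, hmono, hle⟩ := compatible_iff.1 a.2
    refine ⟨hmono, ?_⟩
    simp only [Pi.add_apply, ascentsBefore_last]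
    omega
  · obtain ⟨A, hA, hmono, hle⟩ := A
    refine compatible_iff.2 ⟨odd_oddExtension _, ?_, ?_⟩
    · rwa [apply_pos hA, sub_add_cancel]
    · rw [congrFun (apply_pos hA), Pi.sub_apply, ascentsBefore_last]
      omega
  · rw [apply_pos (label_zero a.2.odd), add_sub_cancel_right]
  · dsimp only
    rw [apply_pos A.2.1, sub_add_cancel]

end SignedPerm

/-! ### Orbits of a fixed-point-free signed involution -/

section FinsetLemmas

open Finset

theorem card_finset_sym {α : Type*} [DecidableEq α] (s : Finset α) (n : ℕ) :
    (s.sym n).card = s.card.multichoose n := by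
  have h := sym_map (n := n) (Function.Embedding.subtype (· ∈ s)) s.attach
  rw [attach_map_val] at h
  rw [h, card_map, ← univ_eq_attach, sym_univ, card_univ, Sym.card_sym_eq_multichoose,
    Fintype.card_coe]

theorem eq_of_monotone_of_map_univ_eq {ι L : Type*} [Fintype ι] [LinearOrder ι] [LinearOrder L]
    {f g : ι → L} (hf : Monotone f) (hg : Monotone g)
    (h : univ.val.map f = univ.val.map g) : f = g := by
  have sorted {f : ι → L} (hf : Monotone f) : ((univ.sort (α := ι)).map f).SortedLE :=
    ((pairwise_sort univ (· ≤ ·)).map f fun _ _ h => hf h).sortedLE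
  have perm : ((univ.sort (α := ι)).map f).Perm ((univ.sort (α := ι)).map g) := by
    rw [← Multiset.coe_eq_coe, ← Multiset.map_coe, ← Multiset.map_coe, sort_eq, h]
  funext x
  exact List.map_inj_left.1 (perm.eq_of_sortedLE (sorted hf) (sorted hg)) x (by simp)

theorem exists_map_univ_val_eq {α : Type*} {n : ℕ} {s : Multiset α} (hs : s.card = n) :
    ∃ p : Fin n → α, univ.val.map p = s := by
  obtain ⟨l, rfl⟩ := Quot.exists_rep s
  obtain rfl : l.length = n := hs
  exact ⟨l.get, by rw [Fin.univ_val_map, List.ofFn_get]; rfl⟩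

/-- The pairs `(c, d)` with `-c ≤ d < c ≤ r`: one representative of each orbit of
`(c, d) ↦ (d, c)` and `(c, d) ↦ (-c, -d)` on the square `[-r, r]²`, except that the diagonal is
omitted. -/
noncomputable def wedge (r : ℕ) : Finset (ℤ × ℤ) :=
  (Icc (-r : ℤ) r ×ˢ Icc (-r : ℤ) r).filter fun p => -p.1 ≤ p.2 ∧ p.2 < p.1

theorem mem_wedge {r : ℕ} {p : ℤ × ℤ} : p ∈ wedge r ↔ p.1 ≤ r ∧ -p.1 ≤ p.2 ∧ p.2 < p.1 := by
  simp only [wedge, mem_filter, mem_product, mem_Icc]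
  omega

theorem card_wedge (r : ℕ) : (wedge r).card = r * (r + 1) := by
  induction r with
  | zero => decide
  | succ r ih =>
    have union : wedge (r + 1) =
        wedge r ∪ {(r + 1 : ℤ)} ×ˢ Ico (-(r + 1 : ℤ)) (r + 1) := by
      ext p
      simp only [mem_union, mem_wedge, mem_product, mem_singleton, mem_Ico]
      omega
    have disjoint : Disjoint (wedge r) ({(r + 1 : ℤ)} ×ˢ Ico (-(r + 1 : ℤ)) (r + 1)) := by
      simp only [disjoint_left, mem_wedge, mem_product, mem_singleton]
      omega
    rw [union, card_union_of_disjoint disjoint, ih, card_product, card_singleton, Int.card_Ico]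
    grind

end FinsetLemmas

namespace SignedPerm

open SignedSet Finset

variable {N r : ℕ} {π π' : SignedPerm N} {a a' : SignedSet N → ℤ}

/-- The largest elements of the orbits `{x, -x, π x, -π x}` with `x ≠ 0`, for `π` a
fixed-point-free signed involution. -/
noncomputable def orbitTops (π : SignedPerm N) : Finset (SignedSet N) :=
  univ.filter fun x => π.1 x < x ∧ -π.1 x < x

theorem mem_orbitTops {x : SignedSet N} : x ∈ orbitTops π ↔ π.1 x < x ∧ -π.1 x < x := by
  simp [orbitTops]

theorem sum_eq_add_sum_orbitTops {M : Type*} [AddCommMonoid M]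
    (hπ : IsFixedPointFreeInvolution π) (g : SignedSet N → M) :
    ∑ x, g x = g 0 + ∑ x ∈ orbitTops π, (g x + g (-x) + g (π.1 x) + g (-π.1 x)) := by
  obtain ⟨involutive, fpf⟩ := isFixedPointFreeInvolution_iff.1 hπ
  -- Exactly one of `x`, `-x`, `π x`, `-π x` is the top of the orbit of `x ≠ 0`.
  have split (x : SignedSet N) : g x = (if x = 0 then g x else 0) +
      ((if x ∈ orbitTops π then g x else 0) + (if -x ∈ orbitTops π then g x else 0) +
        (if π.1 x ∈ orbitTops π then g x else 0) + if π.1 (-x) ∈ orbitTops π then g x else 0) := by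
    rcases eq_or_ne x 0 with rfl | hx
    · simp [mem_orbitTops, apply_zero]
    have image_ne : (π.1 x : ℤ) ≠ x := fun h => (fpf x hx).1 (Subtype.ext h)
    have image_ne_neg : (π.1 x : ℤ) ≠ -x := fun h => (fpf x hx).2 (Subtype.ext h)
    simp only [mem_orbitTops, apply_odd π x, apply_odd π (π.1 x), involutive x,
      ← Subtype.coe_lt_coe, coe_neg, hx, if_false, zero_add]
    split_ifs <;> first | omega | simp only [zero_add, add_zero]
  have reindex {e : SignedSet N → SignedSet N} (he : Function.Involutive e) :
      ∑ x, (if e x ∈ orbitTops π then g x else 0) = ∑ x ∈ orbitTops π, g (e x) := by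
    rw [← Equiv.sum_comp he.toPerm]
    simp only [Function.Involutive.coe_toPerm, he _, sum_ite_mem, univ_inter]
  have involutive_comp_neg : Function.Involutive fun x => π.1 (-x) := fun x => by
    dsimp only
    rw [apply_odd π x, neg_neg, involutive x]
  rw [Finset.sum_congr rfl fun x _ => split x]
  simp only [sum_add_distrib, reindex involutive, reindex neg_involutive,
    reindex involutive_comp_neg, reindex (e := fun x => x) fun _ => rfl]
  simp [apply_odd π _]

/-- The pair of labels at `x` and at `π x`. -/
def labelPair (π : SignedPerm N) (a : SignedSet N → ℤ) (x : SignedSet N) : ℤ × ℤ :=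
  (a x, a (π.1 x))

/-- The multiset of label pairs at the largest elements of the nonzero orbits; it turns out to
determine both `π` and the compatible labelling `a`. -/
noncomputable def orbitLabels (π : SignedPerm N) (a : SignedSet N → ℤ) : Multiset (ℤ × ℤ) :=
  (orbitTops π).val.map (labelPair π a)

theorem card_orbitTops {n : ℕ} {π : SignedPerm (2 * n)} (hπ : IsFixedPointFreeInvolution π) :
    (orbitTops π).card = n := by
  have h := sum_eq_add_sum_orbitTops hπ fun _ => 1
  simp only [sum_const, card_univ, SignedSet.card_eq, smul_eq_mul] at h
  omega

theorem map_labelPair_univ (hπ : IsFixedPointFreeInvolution π) (ha : a.Odd) :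
    univ.val.map (labelPair π a) =
      {0} + ((orbitLabels π a).map fun p => {p} + {-p} + {p.swap} + {-p.swap}).sum := by
  have involutive := (isFixedPointFreeInvolution_iff.1 hπ).1
  have at_zero : labelPair π a 0 = 0 := by simp [labelPair, apply_zero, ha.map_zero]
  rw [← Multiset.sum_map_singleton (univ.val.map _), orbitLabels, Multiset.map_map,
    Multiset.map_map]
  refine (sum_eq_add_sum_orbitTops hπ fun x => {labelPair π a x}).trans ?_
  rw [at_zero]
  refine congrArg _ (sum_congr rfl fun x _ => ?_)
  simp [labelPair, ha _, apply_odd π _, involutive _]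

theorem Compatible.monotone_labelPair (ha : Compatible π r a) :
    Monotone fun x => toLex (labelPair π a x) := by
  intro x y hxy
  rw [Prod.Lex.toLex_le_toLex]
  rcases Prod.Lex.toLex_le_toLex.1 (ha.strictMono.monotone hxy) with h | ⟨h, hπ⟩
  · exact Or.inl h
  · exact Or.inr ⟨h, ha.monotone hπ⟩

theorem Compatible.mem_wedge_of_mem_orbitLabels (ha : Compatible π r a)
    (hπ : IsFixedPointFreeInvolution π) : ∀ p ∈ orbitLabels π a, p ∈ wedge r := by
  have involutive := (isFixedPointFreeInvolution_iff.1 hπ).1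
  intro p hp
  obtain ⟨x, hx : x ∈ orbitTops π, rfl⟩ := Multiset.mem_map.1 hp
  obtain ⟨image_lt, neg_image_lt⟩ := mem_orbitTops.1 hx
  have label_neg_image_le : a (-π.1 x) ≤ a x := ha.monotone neg_image_lt.le
  have label_image_lt : a (π.1 x) < a x := by
    have h := ha.strictMono image_lt
    rw [Prod.Lex.toLex_lt_toLex] at h
    simp only [involutive x] at h
    exact h.resolve_right fun h => h.2.not_gt image_lt
  rw [ha.odd] at label_neg_image_le
  exact mem_wedge.2 ⟨ha.le x, neg_le.1 label_neg_image_le, label_image_lt⟩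

theorem Compatible.eq_of_labelPair_eq (ha : Compatible π r a) (ha' : Compatible π' r a)
    (hπ : IsFixedPointFreeInvolution π) (hπ' : IsFixedPointFreeInvolution π')
    (h : labelPair π a = labelPair π' a) : π = π' := by
  have range_eq {π : SignedPerm N} (hπ : IsFixedPointFreeInvolution π) :
      Set.range (fun x => toLex (a x, (π.1 x : ℤ))) =
        Set.range fun y => toLex ((labelPair π a y).2, (y : ℤ)) := by
    rw [← π.1.surjective.range_comp]
    simp only [Function.comp_def, (isFixedPointFreeInvolution_iff.1 hπ).1 _, labelPair]
  have key : (fun x => toLex (a x, (π.1 x : ℤ))) = fun x => toLex (a x, (π'.1 x : ℤ)) := by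
    rw [← ha.strictMono.range_inj ha'.strictMono, range_eq hπ, range_eq hπ', h]
  refine Subtype.ext (Equiv.ext fun x => Subtype.ext ?_)
  exact congrArg (fun v => (ofLex v).2) (congrFun key x)

theorem Compatible.eq_of_orbitLabels_eq (ha : Compatible π r a) (ha' : Compatible π' r a')
    (hπ : IsFixedPointFreeInvolution π) (hπ' : IsFixedPointFreeInvolution π')
    (h : orbitLabels π a = orbitLabels π' a') : π = π' ∧ a = a' := by
  have labelPair_eq : labelPair π a = labelPair π' a' := by
    have univ_eq : univ.val.map (labelPair π a) = univ.val.map (labelPair π' a') := by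
      rw [map_labelPair_univ hπ ha.odd, map_labelPair_univ hπ' ha'.odd, h]
    refine funext fun x => toLex.injective (congrFun (eq_of_monotone_of_map_univ_eq
      ha.monotone_labelPair ha'.monotone_labelPair ?_) x)
    simpa only [Multiset.map_map, Function.comp_def] using congrArg (Multiset.map toLex) univ_eq
  obtain rfl : a = a' := funext fun x => congrArg Prod.fst (congrFun labelPair_eq x)
  exact ⟨ha.eq_of_labelPair_eq ha' hπ hπ' labelPair_eq, rfl⟩

end SignedPerm

/-! ### Recovering the involution from a multiset of pairs -/

theorem SignedSet.exists_odd_orderIso {L : Type*} [AddCommGroup L] [LinearOrder L]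
    [IsOrderedAddMonoid L] {N : ℕ} {E : Finset L} (neg_mem : ∀ v ∈ E, -v ∈ E)
    (card_eq : E.card = 2 * N + 1) : ∃ φ : SignedSet N ≃o E, ∀ x, (φ (-x) : L) = -φ x := by
  let φ : SignedSet N ≃o E :=
    (monoEquivOfFin _ SignedSet.card_eq).symm.trans (E.orderIsoOfFin card_eq)
  have strictMono : StrictMono fun x => (φ x : L) := φ.strictMono
  -- `x ↦ -φ (-x)` increases and has the same range as `φ`, hence equals `φ`.
  have strictMono_neg : StrictMono fun x => -(φ (-x) : L) := fun x y h =>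
    neg_lt_neg (strictMono (SignedSet.neg_lt_neg_iff.2 h))
  have range_eq : Set.range (fun x => (φ x : L)) = E := by
    rw [← Subtype.range_coe (s := (E : Set L)), ← φ.surjective.range_comp]
    rfl
  have range_neg_eq : Set.range (fun x => -(φ (-x) : L)) = E := by
    refine (Set.range_subset_iff.2 fun x => neg_mem _ (φ (-x)).2).antisymm fun v hv => ?_
    exact ⟨-φ.symm ⟨-v, neg_mem v hv⟩, by simp⟩
  have := (strictMono_neg.range_inj strictMono).1 (range_neg_eq.trans range_eq.symm)
  exact ⟨φ, fun x => neg_eq_iff_eq_neg.1 (congrFun this x)⟩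

/-- The involution `(c, d, t) ↦ (d, c, t)` of triples ordered lexicographically. An element `x` of
`Ω_N` is encoded by a triple `(a x, a (π x), t)`, so that the swap encodes `π`. -/
def swapLex (v : ℤ ×ₗ ℤ ×ₗ ℤ) : ℤ ×ₗ ℤ ×ₗ ℤ :=
  toLex ((ofLex (ofLex v).2).1, toLex ((ofLex v).1, (ofLex (ofLex v).2).2))

theorem swapLex_involutive : Function.Involutive swapLex := fun _ => rfl

theorem swapLex_neg (v : ℤ ×ₗ ℤ ×ₗ ℤ) : swapLex (-v) = -swapLex v := rfl

namespace SignedPerm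

open SignedSet Finset

variable {N r : ℕ}

theorem exists_compatible_of_swapLex {E : Finset (ℤ ×ₗ ℤ ×ₗ ℤ)} (card_eq : E.card = 2 * N + 1)
    (neg_mem : ∀ v ∈ E, -v ∈ E) (swap_mem : ∀ v ∈ E, swapLex v ∈ E)
    (le : ∀ v ∈ E, (ofLex v).1 ≤ r)
    (fpf : ∀ v ∈ E, v ≠ 0 → swapLex v ≠ v ∧ swapLex v ≠ -v) :
    ∃ (π : SignedPerm N) (a : SignedSet N → ℤ) (φ : SignedSet N ≃o E),
      IsFixedPointFreeInvolution π ∧ Compatible π r a ∧ (∀ x, (φ (-x)).1 = -(φ x).1) ∧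
        (∀ x, a x = (ofLex (φ x).1).1) ∧ ∀ x, (φ (π.1 x)).1 = swapLex (φ x) := by
  obtain ⟨φ, odd⟩ := exists_odd_orderIso neg_mem card_eq
  let swapE : Equiv.Perm E := Function.Involutive.toPerm (fun v => ⟨swapLex v, swap_mem _ v.2⟩)
    fun v => Subtype.ext (swapLex_involutive v)
  let e : Equiv.Perm (SignedSet N) := φ.toEquiv.symm.permCongr swapE
  have apply_e (x) : (φ (e x)).1 = swapLex (φ x) := by
    simp only [e, swapE, Equiv.permCongr_apply, Equiv.symm_symm]
    exact congrArg Subtype.val (φ.apply_symm_apply _)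
  have eq_iff {x y : SignedSet N} : x = y ↔ (φ x).1 = (φ y).1 := by
    rw [Subtype.coe_inj, φ.injective.eq_iff]
  let π : SignedPerm N := ⟨e, fun x => eq_iff.2 (by
    rw [apply_e, odd x, odd (e x), swapLex_neg, apply_e])⟩
  refine ⟨π, fun x => (ofLex (φ x).1).1, φ, isFixedPointFreeInvolution_iff.2 ⟨?_, ?_⟩,
    ⟨?_, ?_, fun x => le _ (φ x).2⟩, odd, fun _ => rfl, apply_e⟩
  · exact fun x => eq_iff.2 (by rw [apply_e, apply_e, swapLex_involutive])
  · intro x hx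
    have ne_zero : (φ x).1 ≠ 0 := by
      rw [← Function.Odd.map_zero (f := fun x => (φ x).1) odd, Ne, ← eq_iff]
      exact hx
    obtain ⟨h, h_neg⟩ := fpf _ (φ x).2 ne_zero
    rw [Ne, Ne, eq_iff, eq_iff, odd x, apply_e]
    exact ⟨h, h_neg⟩
  · intro x
    simp only [odd x]
    rfl
  · intro x y hxy
    have h : (φ x).1 < (φ y).1 := φ.strictMono hxy
    have image_lt_iff : (e x : ℤ) < e y ↔ swapLex (φ x) < swapLex (φ y) := by
      rw [← apply_e, ← apply_e, Subtype.coe_lt_coe, Subtype.coe_lt_coe, φ.lt_iff_lt]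
    rw [Prod.Lex.toLex_lt_toLex, image_lt_iff]
    simp only [Prod.Lex.lt_iff, swapLex, ofLex_toLex] at h ⊢
    grind

end SignedPerm

namespace SignedSet

open SignedPerm Finset

variable {n r : ℕ} {p : Fin n → ℤ × ℤ}

/-- The pairs `±p i`, the sign and the index `i` being recorded by `t` in order to tell equal pairs
apart. -/
def taggedPair (p : Fin n → ℤ × ℤ) (t : SignedSet n) : ℤ ×ₗ ℤ ×ₗ ℤ :=
  let q := oddExtension (Fin.cons 0 p) t
  toLex (q.1, toLex (q.2, (t : ℤ)))

theorem taggedPair_neg (p : Fin n → ℤ × ℤ) (t : SignedSet n) :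
    taggedPair p (-t) = -taggedPair p t := by
  simp only [taggedPair, odd_oddExtension _ t]
  rfl

theorem taggedPair_pos_succ (p : Fin n → ℤ × ℤ) (i : Fin n) :
    taggedPair p (pos i.succ) = toLex ((p i).1, toLex ((p i).2, (i.succ : ℤ))) := by
  simp [taggedPair, oddExtension_pos (B := Fin.cons 0 p) rfl]

theorem taggedPair_injective (p : Fin n → ℤ × ℤ) : (taggedPair p).Injective := fun _ _ h =>
  Subtype.ext (congrArg (fun v => (ofLex (ofLex v).2).2) h)

theorem taggedPair_zero (p : Fin n → ℤ × ℤ) : taggedPair p 0 = 0 :=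
  Function.Odd.map_zero (taggedPair_neg p)

theorem abs_taggedPair_le (hp : ∀ i, p i ∈ wedge r) (t : SignedSet n) :
    |(ofLex (taggedPair p t)).1| ≤ r ∧ |(ofLex (swapLex (taggedPair p t))).1| ≤ r := by
  revert t
  refine (forall_iff_pos fun t ht => ?_).2 (Fin.cases ?_ fun i => ?_)
  · rw [taggedPair_neg, swapLex_neg]
    change |-_| ≤ _ ∧ |-_| ≤ _
    rwa [abs_neg, abs_neg]
  · rw [pos_zero, taggedPair_zero]
    simp [swapLex]
  · have := mem_wedge.1 (hp i)
    simp only [taggedPair_pos_succ, swapLex, ofLex_toLex, abs_le]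
    omega

theorem swapLex_taggedPair_ne (hp : ∀ i, p i ∈ wedge r) (t : SignedSet n) (ht : t ≠ 0) :
    swapLex (taggedPair p t) ≠ taggedPair p t := by
  revert t
  rw [forall_iff_pos fun t ht => ?_, Fin.forall_fin_succ]
  · refine ⟨fun h => (h rfl).elim, fun i _ h => ?_⟩
    rw [taggedPair_pos_succ] at h
    exact (mem_wedge.1 (hp i)).2.2.ne (congrArg (fun v => (ofLex v).1) h)
  · rwa [taggedPair_neg, swapLex_neg, Ne, Ne, neg_inj, neg_eq_iff_eq_neg, neg_zero]

/-- All the pairs `±p i` and their swaps, tagged. -/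
noncomputable def taggedOrbits (p : Fin n → ℤ × ℤ) : Finset (ℤ ×ₗ ℤ ×ₗ ℤ) :=
  univ.image (taggedPair p) ∪ univ.image (swapLex ∘ taggedPair p)

theorem mem_taggedOrbits {v : ℤ ×ₗ ℤ ×ₗ ℤ} :
    v ∈ taggedOrbits p ↔ ∃ t, v = taggedPair p t ∨ v = swapLex (taggedPair p t) := by
  simp [taggedOrbits, exists_or, eq_comm]

theorem neg_mem_taggedOrbits {v : ℤ ×ₗ ℤ ×ₗ ℤ} (hv : v ∈ taggedOrbits p) :
    -v ∈ taggedOrbits p := by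
  rw [mem_taggedOrbits] at hv ⊢
  obtain ⟨t, rfl | rfl⟩ := hv
  · exact ⟨-t, Or.inl (taggedPair_neg p t).symm⟩
  · exact ⟨-t, Or.inr (by rw [taggedPair_neg, swapLex_neg])⟩

theorem swapLex_mem_taggedOrbits {v : ℤ ×ₗ ℤ ×ₗ ℤ} (hv : v ∈ taggedOrbits p) :
    swapLex v ∈ taggedOrbits p := by
  rw [mem_taggedOrbits] at hv ⊢
  obtain ⟨t, rfl | rfl⟩ := hv
  · exact ⟨t, Or.inr rfl⟩
  · exact ⟨t, Or.inl rfl⟩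

theorem fst_le_of_mem_taggedOrbits (hp : ∀ i, p i ∈ wedge r) {v : ℤ ×ₗ ℤ ×ₗ ℤ}
    (hv : v ∈ taggedOrbits p) : (ofLex v).1 ≤ r := by
  obtain ⟨t, rfl | rfl⟩ := mem_taggedOrbits.1 hv
  · exact (le_abs_self _).trans (abs_taggedPair_le hp t).1
  · exact (le_abs_self _).trans (abs_taggedPair_le hp t).2

theorem swapLex_ne_of_mem_taggedOrbits (hp : ∀ i, p i ∈ wedge r) {v : ℤ ×ₗ ℤ ×ₗ ℤ}
    (hv : v ∈ taggedOrbits p) (hv0 : v ≠ 0) : swapLex v ≠ v ∧ swapLex v ≠ -v := by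
  obtain ⟨t, ht⟩ := mem_taggedOrbits.1 hv
  have tag_eq : (ofLex (ofLex v).2).2 = (t : ℤ) := by rcases ht with rfl | rfl <;> rfl
  have t_ne : t ≠ 0 := by
    rintro rfl
    rcases ht with rfl | rfl <;> simp [taggedPair_zero, swapLex] at hv0
  refine ⟨?_, fun h => t_ne (Subtype.ext ?_)⟩
  · rcases ht with rfl | rfl
    · exact swapLex_taggedPair_ne hp t t_ne
    · exact (swapLex_taggedPair_ne hp t t_ne).symm
  · have : (ofLex (ofLex v).2).2 = -(ofLex (ofLex v).2).2 :=
      congrArg (fun v => (ofLex (ofLex v).2).2) h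
    rw [tag_eq] at this
    exact self_eq_neg.1 this

theorem card_taggedOrbits (hp : ∀ i, p i ∈ wedge r) :
    (taggedOrbits p).card = 2 * (2 * n) + 1 := by
  have inter : univ.image (taggedPair p) ∩ univ.image (swapLex ∘ taggedPair p) = {0} := by
    refine eq_singleton_iff_unique_mem.2 ⟨?_, fun v hv => ?_⟩
    · have mem := mem_image_of_mem (taggedPair p) (mem_univ 0)
      rw [taggedPair_zero] at mem
      exact mem_inter.2 ⟨mem, mem_image.2 ⟨0, mem_univ _, by simp [taggedPair_zero, swapLex]⟩⟩
    · obtain ⟨⟨t, -, rfl⟩, u, -, h⟩ := mem_inter.1 hv |>.imp mem_image.1 mem_image.1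
      obtain rfl : u = t := Subtype.ext (congrArg (fun v => (ofLex (ofLex v).2).2) h)
      rcases eq_or_ne u 0 with rfl | hu
      · exact taggedPair_zero p
      · exact (swapLex_taggedPair_ne hp u hu h).elim
  have h := card_union_add_card_inter (univ.image (taggedPair p))
    (univ.image (swapLex ∘ taggedPair p))
  rw [inter, card_singleton, card_image_of_injective _ (taggedPair_injective p),
    card_image_of_injective _ (swapLex_involutive.injective.comp (taggedPair_injective p)),
    card_univ, SignedSet.card_eq] at h
  rw [taggedOrbits]
  omega

end SignedSet

namespace SignedPerm

open SignedSet Finset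

variable {n r : ℕ}

theorem exists_orbitLabels_eq {p : Fin n → ℤ × ℤ} (hp : ∀ i, p i ∈ wedge r) :
    ∃ (π : SignedPerm (2 * n)) (a : SignedSet (2 * n) → ℤ), IsFixedPointFreeInvolution π ∧
      Compatible π r a ∧ orbitLabels π a = univ.val.map p := by
  obtain ⟨π, a, φ, hπ, ha, odd, label, image⟩ := exists_compatible_of_swapLex (r := r)
    (card_taggedOrbits hp) (fun _ => neg_mem_taggedOrbits) (fun _ => swapLex_mem_taggedOrbits)
    (fun _ => fst_le_of_mem_taggedOrbits hp) (fun _ => swapLex_ne_of_mem_taggedOrbits hp)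
  refine ⟨π, a, hπ, ha, ?_⟩
  let top (i : Fin n) : SignedSet (2 * n) :=
    φ.symm ⟨taggedPair p (pos i.succ), mem_taggedOrbits.2 ⟨_, Or.inl rfl⟩⟩
  have apply_top (i) : (φ (top i)).1 = taggedPair p (pos i.succ) :=
    congrArg Subtype.val (φ.apply_symm_apply _)
  have top_injective : top.Injective := by
    intro i j h
    have : taggedPair p (pos i.succ) = taggedPair p (pos j.succ) := by
      rw [← apply_top, ← apply_top, h]
    exact Fin.succ_injective _ (pos_strictMono.injective (taggedPair_injective p this))
  have lt_iff {x y : SignedSet (2 * n)} : x < y ↔ (φ x).1 < (φ y).1 := φ.lt_iff_lt.symm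
  have top_mem (i) : top i ∈ orbitTops π := by
    have := mem_wedge.1 (hp i)
    rw [mem_orbitTops, lt_iff, lt_iff, odd, image, apply_top, taggedPair_pos_succ]
    simp only [Prod.Lex.lt_iff, swapLex, ofLex_toLex, ofLex_neg, Prod.fst_neg, Prod.snd_neg,
      Fin.val_succ]
    omega
  have image_top : univ.map ⟨top, top_injective⟩ = orbitTops π :=
    eq_of_subset_of_card_le (by simpa [subset_iff] using top_mem) (by
      rw [card_map, card_univ, Fintype.card_fin, card_orbitTops hπ])
  rw [orbitLabels, ← image_top, map_val, Multiset.map_map]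
  refine Multiset.map_congr rfl fun i _ => ?_
  simp [labelPair, label, image, apply_top, taggedPair_pos_succ, swapLex]

open scoped Classical in
/-- The fixed-point-free signed involutions of length `N`. -/
noncomputable def fpfInvolutions (N : ℕ) : Finset (SignedPerm N) :=
  univ.filter IsFixedPointFreeInvolution

theorem mem_fpfInvolutions {N : ℕ} {π : SignedPerm N} :
    π ∈ fpfInvolutions N ↔ IsFixedPointFreeInvolution π := by
  simp [fpfInvolutions]

theorem finite_compatible {N : ℕ} (π : SignedPerm N) (r : ℕ) :
    Finite {a // Compatible π r a} := by
  refine ((Set.finite_Icc (fun _ => -(r : ℤ)) fun _ => (r : ℤ)).subset fun a ha => ?_).to_subtype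
  exact ⟨fun x => neg_le.1 (ha.odd x ▸ ha.le (-x)), ha.le⟩

theorem sum_card_compatible (n r : ℕ) :
    ∑ π ∈ fpfInvolutions (2 * n), Nat.card {a // Compatible π r a} =
      (r * (r + 1)).multichoose n := by
  have := fun π : SignedPerm (2 * n) => finite_compatible π r
  let labels : (Σ π : fpfInvolutions (2 * n), {a // Compatible π.1 r a}) → (wedge r).sym n :=
    fun x => ⟨⟨orbitLabels x.1.1 x.2.1, by
      rw [orbitLabels, Multiset.card_map, card_val, card_orbitTops (mem_fpfInvolutions.1 x.1.2)]⟩,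
      mem_sym_iff.2 (x.2.2.mem_wedge_of_mem_orbitLabels (mem_fpfInvolutions.1 x.1.2))⟩
  have bijective : labels.Bijective := by
    constructor
    · rintro ⟨⟨π, hπ⟩, a, ha⟩ ⟨⟨π', hπ'⟩, a', ha'⟩ h
      obtain ⟨rfl, rfl⟩ := ha.eq_of_orbitLabels_eq ha' (mem_fpfInvolutions.1 hπ)
        (mem_fpfInvolutions.1 hπ') (congrArg (fun s => s.1.1) h)
      rfl
    · rintro ⟨⟨s, hs⟩, hsym⟩
      have mem : ∀ q ∈ s, q ∈ wedge r := mem_sym_iff.1 hsym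
      obtain ⟨p, rfl⟩ := exists_map_univ_val_eq hs
      obtain ⟨π, a, hπ, ha, h⟩ := exists_orbitLabels_eq (p := p) (r := r)
        fun i => mem _ (Multiset.mem_map_of_mem p (mem_univ i))
      exact ⟨⟨⟨π, mem_fpfInvolutions.2 hπ⟩, a, ha⟩, Subtype.ext (Subtype.ext h)⟩
  rw [← card_wedge, ← card_finset_sym, ← Fintype.card_coe, ← Nat.card_eq_fintype_card,
    ← Nat.card_eq_of_bijective _ bijective, Nat.card_sigma, ← Finset.sum_coe_sort]

theorem card_filter_des_eq (N k : ℕ) :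
    ((fpfInvolutions N).filter (des · = k)).card = numFPFInvolutions N k := by
  rw [numFPFInvolutions, ← Set.ncard_coe_finset]
  simp [mem_fpfInvolutions]

theorem numFPFInvolutions_of_neg (N : ℕ) {k : ℤ} (hk : k < 0) : numFPFInvolutions N k = 0 := by
  rw [numFPFInvolutions, Set.ncard_eq_zero, Set.eq_empty_iff_forall_notMem]
  rintro π ⟨-, hπ⟩
  omega

end SignedPerm

/-! ### The generating function and the recurrence -/

namespace SignedPerm

open PowerSeries

theorem mk_numFPFInvolutions (N : ℕ) :
    (mk fun k => (numFPFInvolutions N k : ℤ)) = ∑ π ∈ fpfInvolutions N, (X : ℤ⟦X⟧) ^ des π := by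
  ext k
  simp only [coeff_mk, map_sum, coeff_X_pow, Finset.sum_boole, ← card_filter_des_eq, eq_comm]

theorem mk_card_compatible_mul_one_sub_X_pow {N : ℕ} (π : SignedPerm N) :
    (mk fun r => (Nat.card {a // Compatible π r a} : ℤ)) * (1 - X) ^ (N + 1) = X ^ des π := by
  have h : (mk fun r => (Nat.card {a // Compatible π r a} : ℤ)) =
      X ^ des π * mk fun r => ((N + r).choose N : ℤ) := by
    ext r
    rw [coeff_X_pow_mul', coeff_mk, card_compatible]
    split_ifs with hr
    · rw [coeff_mk]
      congr 2
      omega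
    · rw [Nat.choose_eq_zero_of_lt (by have := des_le π; omega), Nat.cast_zero]
  rw [h, mul_assoc, mk_add_choose_mul_one_sub_pow_eq_one, mul_one]

theorem mk_multichoose_mul_one_sub_X_pow (n : ℕ) :
    (mk fun r => ((r * (r + 1)).multichoose n : ℤ)) * (1 - X) ^ (2 * n + 1) =
      mk fun k => (numFPFInvolutions (2 * n) k : ℤ) := by
  have h : (mk fun r => ((r * (r + 1)).multichoose n : ℤ)) =
      ∑ π ∈ fpfInvolutions (2 * n), mk fun r => (Nat.card {a // Compatible π r a} : ℤ) := by
    ext r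
    simp [← sum_card_compatible]
  rw [h, Finset.sum_mul, mk_numFPFInvolutions]
  exact Finset.sum_congr rfl fun π _ => mk_card_compatible_mul_one_sub_X_pow π

theorem succ_mul_numFPFInvolutions (n k : ℕ) :
    ((n + 1 : ℕ) : ℤ) * numFPFInvolutions (2 * (n + 1)) k =
      (k ^ 2 + k + n) * numFPFInvolutions (2 * n) k
      + 2 * ((k - 1) * (2 * n + 1 - k) + (n + 1)) * numFPFInvolutions (2 * n) (k - 1)
      + ((2 * n + 2 - k) * (2 * n + 3 - k) + n) * numFPFInvolutions (2 * n) (k - 2) := by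
  have h := three_term_of_mul_one_sub_X_pow (b := (n + 1 : ℕ)) (c := n)
    (g := fun k => numFPFInvolutions (2 * n) k)
    (g' := fun k => numFPFInvolutions (2 * (n + 1)) k)
    (fun r => ?_) (mk_multichoose_mul_one_sub_X_pow n) (mk_multichoose_mul_one_sub_X_pow (n + 1))
    (fun k hk => by rw [numFPFInvolutions_of_neg _ hk, Nat.cast_zero]) k
  · push_cast at h ⊢
    rw [h]
    ring
  · have := succ_mul_multichoose_succ (r * (r + 1)) n
    zify at this
    push_cast
    linear_combination this

theorem numFPFInvolutions_zero (k : ℤ) : numFPFInvolutions 0 k = if k = 0 then 1 else 0 := by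
  rcases lt_or_ge k 0 with hk | hk
  · rw [numFPFInvolutions_of_neg _ hk, if_neg hk.ne]
  lift k to ℕ using hk
  have h := congrArg (coeff k) (mk_multichoose_mul_one_sub_X_pow 0)
  simp only [Nat.multichoose_zero_right, Nat.cast_one, mul_zero, zero_add, pow_one, coeff_mk] at h
  rw [show (mk fun _ => 1 : ℤ⟦X⟧) * (1 - X) = 1 from mk_one_mul_one_sub_eq_one ℤ, coeff_one] at h
  exact_mod_cast h.symm

theorem numFPFInvolutions_two (k : ℤ) : numFPFInvolutions 2 k = if k = 1 then 2 else 0 := by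
  rcases lt_or_ge k 0 with hk | hk
  · rw [numFPFInvolutions_of_neg _ hk, if_neg (by omega)]
  lift k to ℕ using hk
  have h := succ_mul_numFPFInvolutions 0 k
  simp only [zero_add, mul_zero, mul_one, numFPFInvolutions_zero] at h
  grind

end SignedPerm

theorem mainTheorem6 :
    (∀ (n : ℕ) (k : ℤ), 2 ≤ n → 0 ≤ k →
      (n : ℤ) * (SignedPerm.numFPFInvolutions (2 * n) k : ℤ) =
        (k ^ 2 + k + (n : ℤ) - 1) * (SignedPerm.numFPFInvolutions (2 * n - 2) k : ℤ)
        + 2 * ((k - 1) * (2 * (n : ℤ) - k - 1) + (n : ℤ)) *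
            (SignedPerm.numFPFInvolutions (2 * n - 2) (k - 1) : ℤ)
        + ((2 * (n : ℤ) - k) * (2 * (n : ℤ) - k + 1) + ((n : ℤ) - 1)) *
            (SignedPerm.numFPFInvolutions (2 * n - 2) (k - 2) : ℤ)) ∧
    SignedPerm.numFPFInvolutions 2 0 = 0 ∧
    SignedPerm.numFPFInvolutions 2 1 = 2 ∧
    SignedPerm.numFPFInvolutions 2 2 = 0 ∧
    (∀ (n : ℕ) (k : ℤ), 1 ≤ n → k < 0 → SignedPerm.numFPFInvolutions (2 * n) k = 0) := by
  refine ⟨fun n k hn hk => ?_, ?_, ?_, ?_, fun n k _ => SignedPerm.numFPFInvolutions_of_neg _⟩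
  · obtain ⟨m, rfl⟩ := Nat.exists_eq_add_of_le' (show 1 ≤ n by omega)
    lift k to ℕ using hk
    rw [SignedPerm.succ_mul_numFPFInvolutions m k, show 2 * (m + 1) - 2 = 2 * m by omega]
    push_cast
    ring
  all_goals simp [SignedPerm.numFPFInvolutions_two]
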